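/- Let $a,b$ be relatively prime integers, and define the first and second Lucas sequences by $U_0=0$, $U_1=1$, $U_{k+2}=aU_{k+1}+bU_k$ and $V_0=2$, $V_1=a$, $V_{k+2}=aV_{k+1}+bV_k$ for $k\ge 0$. Assume that the pair $(a,b)$ is non-degenerate, that is, $b\neq 0$ and the ratio $\alpha/\beta$ of the two roots of $x^2-ax-b$ is not a root of unity, and that $a>0$ and $\Delta=a^2+4b>0$. For a positive integer $N$ relatively prime to $b$, let $\tau(N)$, the order of appearance of $N$, be the smallest integer $k\ge 1$ with $N\mid U_k$. Let $m,n\ge 3$ be integers, let $d=\gcd(m,n)$, let $[m,n]$ be the least common multiple of $m$ and $n$, and let $\nu_2$ denote the $2$-adic valuation. Then $U_mV_n$, $U_mU_n$ and $V_mV_n$ are positive and relatively prime to $b$, and the following hold. (i) $\tau(U_mV_n)=2[m,n]$ if $\nu_2(m)\le\nu_2(n)$, and $\tau(U_mV_n)=[m,n]\,V_d$ if $\nu_2(m)>\nu_2(n)$. (ii) $\tau(U_mU_n)=[m,n]\,U_d$. (iii) $\tau(V_mV_n)=[m,n]\gcd(V_m,V_n)$ if one of the following holds: $2\nmid b$,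 $2\mid a$ and $2\mid d$; or $2\nmid b$, $2\nmid a$ and $3\mid d$; or $2\nmid b$, $2\mid a$, $2\nmid d$ and $\nu_2(m)\ne\nu_2(n)$. And $\tau(V_mV_n)=2[m,n]\gcd(V_m,V_n)$ if one of the following holds: $2\mid b$; or $2\nmid b$, $2\nmid a$ and $3\nmid d$; or $2\nmid b$, $2\mid a$, $2\nmid d$ and $\nu_2(m)=\nu_2(n)$. -/

import Mathlib

namespace LucasPair

/-- The first Lucas sequence `U_n(a,b)`. -/
def U (a b : ℤ) : ℕ → ℤ
  | 0 => 0
  | 1 => 1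
  | n + 2 => a * U a b (n + 1) + b * U a b n

/-- The second Lucas sequence `V_n(a,b)`. -/
def V (a b : ℤ) : ℕ → ℤ
  | 0 => 2
  | 1 => a
  | n + 2 => a * V a b (n + 1) + b * V a b n

/-- The pair `(a,b)` is non-degenerate: `b ≠ 0` and, whenever `α, β` are the two complex roots
(with multiplicity) of `x² - a x - b`, the ratio `α/β` is not a root of unity. -/
def Nondegenerate (a b : ℤ) : Prop :=
  b ≠ 0 ∧ ∀ α β : ℂ, α + β = (a : ℂ) → α * β = -(b : ℂ) → ∀ k : ℕ, 1 ≤ k → (α / β) ^ k ≠ 1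

/-- The integers whose order of appearance is defined: positive and relatively prime to `b`. -/
def Admissible (b N : ℤ) : Prop := 0 < N ∧ IsCoprime N b

/-- The order of appearance of `N` in `(U_n(a,b))`: the smallest `k ≥ 1` with `N ∣ U_k`.
The value is `0` exactly when there is no such `k`. -/
noncomputable def tau (a b N : ℤ) : ℕ := sInf {k : ℕ | 1 ≤ k ∧ N ∣ U a b k}

end LucasPair

namespace LucasPair

/-! ### Addition, duplication and norm identities -/

section Identities

variable (a b : ℤ)

/-! Write m = dr and n = ds with r, s coprime, and let A, B be the two factors. Strong divisibility
and growth give U_m ∣ U_k ↔ m ∣ k and V_n ∣ U_k ↔ 2n ∣ k, so A B ∣ U_k forces M ∣ k with M = [m,n]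
or 2[m,n]. For k = M t one has U_k = U_M X, where a divisor of U_M divides X iff it divides t
(`exists_U_mul_eq_and_dvd_iff`). With g = gcd(A, B) and U_M g = A B Q, the condition A B ∣ U_k
becomes g ∣ Q X. If g is prime to Q, this says g ∣ t, and the order is M g (`mul_dvd_U_iff`).
Coprimality is tested at a prime p ∣ g: p misses r or s, and expanding U_M along the missed index
shows p ∤ Q.

In the mixed case with r odd, and in the V-V case with exactly one of r, s even, A B already divides
U_M and the order is M = 2[m,n]. In the V-V case with r, s odd, M = 2L with L = [m,n], g = V_d and Q
= U_L R with R prime to V_d; but U_L and V_d may share a factor 2, which then halves the order. The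
parity conditions of (iii) detect this. -/

lemma U_zero : U a b 0 = 0 := by simp [U]

lemma U_one : U a b 1 = 1 := by simp [U]

lemma U_add_two (n : ℕ) : U a b (n + 2) = a * U a b (n + 1) + b * U a b n := by simp [U]

lemma V_add_two (n : ℕ) : V a b (n + 2) = a * V a b (n + 1) + b * V a b n := by simp [V]

lemma U_two : U a b 2 = a := by simp [U]

lemma U_three : U a b 3 = a ^ 2 + b := by simp [U]; ring

lemma V_eq (n : ℕ) : V a b n = 2 * U a b (n + 1) - a * U a b n := by
  induction n using Nat.twoStepInduction with
  | zero => simp [U, V]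
  | one => simp [U, V]; ring
  | more n h₁ h₂ =>
    rw [V_add_two, h₁, h₂, U_add_two a b (n + 1), U_add_two a b n]; ring

lemma U_add_add_one (m n : ℕ) :
    U a b (m + n + 1) = U a b (m + 1) * U a b (n + 1) + b * U a b m * U a b n := by
  induction n using Nat.twoStepInduction with
  | zero => simp [U]
  | one => simp [U]; ring
  | more n h₁ h₂ =>
    have e₁ := U_add_two a b (m + n + 1)
    have e₂ := U_add_two a b (n + 1)
    have e₃ := U_add_two a b n
    simp only [← add_assoc] at *
    rw [show m + n + 2 + 1 = m + n + 1 + 2 by ring, e₁,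
      h₂, h₁, show n + 2 + 1 = n + 1 + 2 by ring,
      e₂, e₃]
    ring

lemma U_add (m n : ℕ) :
    U a b (m + n) =
      U a b m * U a b (n + 1) + U a b (m + 1) * U a b n - a * U a b m * U a b n := by
  cases n with
  | zero => simp [U]
  | succ n => rw [← add_assoc, U_add_add_one, U_add_two]; ring

lemma cassini (n : ℕ) :
    U a b (n + 1) ^ 2 - a * U a b (n + 1) * U a b n - b * U a b n ^ 2 = (-b) ^ n := by
  induction n with
  | zero => simp [U]
  | succ n ih => rw [U_add_two, pow_succ (-b), ← ih]; ring

lemma U_two_mul (n : ℕ) : U a b (2 * n) = U a b n * V a b n := by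
  rw [two_mul, U_add, V_eq]; ring

lemma V_sq (n : ℕ) : V a b n ^ 2 = (a ^ 2 + 4 * b) * U a b n ^ 2 + 4 * (-b) ^ n := by
  rw [V_eq, ← cassini]; ring

/-- In terms of the roots α, β, with αβ = -b, this expands (α^(n+d) - β^(n+d))(α^d - β^d). It lets
an induction pass from one odd multiple of d to the next. -/
lemma V_add_two_mul (n d : ℕ) :
    V a b (n + 2 * d) =
      (-b) ^ d * V a b n + (a ^ 2 + 4 * b) * U a b (n + d) * U a b d := by
  rw [V_eq a b (n + 2 * d), V_eq a b n, ← cassini a b d, two_mul d, ← add_assoc,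
    U_add_add_one a b (n + d) d, U_add a b (n + d) d, U_add_add_one a b n d, U_add a b n d]
  ring

end Identities

variable {a b : ℤ}

/-! ### Coprimality, strong divisibility and quotients -/

lemma isCoprime_U_right (hab : IsCoprime a b) (n : ℕ) : IsCoprime (U a b (n + 1)) b := by
  induction n with
  | zero => simpa [U] using isCoprime_one_left
  | succ n ih =>
    rw [U_add_two, mul_comm b]
    exact (IsCoprime.mul_left hab ih).add_mul_right_left _

lemma isCoprime_V_right (hab : IsCoprime a b) (n : ℕ) : IsCoprime (V a b (n + 1)) b := by
  induction n with
  | zero => simpa [V] using hab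
  | succ n ih =>
    rw [V_add_two, mul_comm b]
    exact (IsCoprime.mul_left hab ih).add_mul_right_left _

lemma isCoprime_U_U_succ (hab : IsCoprime a b) (n : ℕ) :
    IsCoprime (U a b n) (U a b (n + 1)) := by
  induction n with
  | zero => simpa [U] using isCoprime_one_right
  | succ n ih =>
    rw [U_add_two, add_comm (a * _)]
    exact (IsCoprime.mul_right (isCoprime_U_right hab n) ih.symm).add_mul_right_right _

/-- Euclid's algorithm by subtraction on indices: modulo D ∣ U_i the addition formula reads U_{i+j}
≡ U_{i+1} U_j, and U_{i+1} is a unit modulo D. -/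
lemma dvd_U_gcd (hab : IsCoprime a b) {D : ℤ} (m n : ℕ) (hm : D ∣ U a b m)
    (hn : D ∣ U a b n) : D ∣ U a b (Nat.gcd m n) := by
  induction h : m + n using Nat.strong_induction_on generalizing m n with
  | _ s ih =>
    have key : ∀ i j : ℕ, 0 < i → D ∣ U a b i → D ∣ U a b (i + j) → i + (i + j) = s →
        D ∣ U a b (Nat.gcd i (i + j)) := by
      intro i j hi hDi hDj hs
      rw [Nat.gcd_self_add_right]
      refine ih (i + j) (by omega) i j hDi ?_ rfl
      have hc : IsCoprime D (U a b (i + 1)) :=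
        (isCoprime_U_U_succ hab i).of_isCoprime_of_dvd_left hDi
      refine hc.dvd_of_dvd_mul_left ?_
      have : U a b (i + 1) * U a b j =
          U a b (i + j) - U a b i * (U a b (j + 1) - a * U a b j) := by
        rw [U_add a b i j]; ring
      rw [this]
      exact dvd_sub hDj (hDi.mul_right _)
    rcases Nat.eq_zero_or_pos m with rfl | hm0
    · simpa using hn
    rcases Nat.eq_zero_or_pos n with rfl | hn0
    · simpa using hm
    rcases le_total m n with hle | hle
    · obtain ⟨j, rfl⟩ := Nat.exists_eq_add_of_le hle
      exact key m j hm0 hm hn h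
    · obtain ⟨j, rfl⟩ := Nat.exists_eq_add_of_le hle
      rw [Nat.gcd_comm]
      exact key n j hn0 hn hm (by omega)

/-- The quotient `U_{mk} / U_m` is congruent to `k U_{m+1}^{k-1}` modulo `U_m`. -/
lemma exists_U_mul_eq (a b : ℤ) (m k : ℕ) : ∃ X : ℤ, U a b (m * k) = U a b m * X ∧
    U a b m ∣ X * U a b (m + 1) - k * U a b (m + 1) ^ k ∧
    U a b m ∣ U a b (m * k + 1) - U a b (m + 1) ^ k := by
  induction k with
  | zero => exact ⟨0, by simp [U], by simp, by simp [U]⟩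
  | succ k ih =>
    obtain ⟨X, hX, ⟨c, hc⟩, ⟨e, he⟩⟩ := ih
    refine ⟨X * U a b (m + 1) + U a b (m * k + 1) - a * U a b m * X, ?_,
      ⟨U a b (m + 1) * c + e * U a b (m + 1) - a * X * U a b (m + 1), ?_⟩,
      ⟨U a b (m + 1) * e + b * U a b m * X, ?_⟩⟩
    · rw [mul_add, mul_one, U_add, hX]; ring
    · push_cast
      linear_combination U a b (m + 1) * hc + U a b (m + 1) * he
    · rw [mul_add, mul_one, U_add_add_one, hX]
      linear_combination U a b (m + 1) * he

lemma U_dvd_U_of_dvd {m k : ℕ} (h : m ∣ k) : U a b m ∣ U a b k := by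
  obtain ⟨j, rfl⟩ := h
  obtain ⟨X, hX, -⟩ := exists_U_mul_eq a b m j
  exact ⟨X, hX⟩

lemma exists_U_mul_eq_and_dvd_iff (hab : IsCoprime a b) (m k : ℕ) :
    ∃ X : ℤ, U a b (m * k) = U a b m * X ∧
      (∀ D, D ∣ U a b m → (D ∣ X ↔ D ∣ (k : ℤ))) := by
  obtain ⟨X, hX, h, -⟩ := exists_U_mul_eq a b m k
  refine ⟨X, hX, fun D hD => ?_⟩
  have hc : IsCoprime D (U a b (m + 1)) := (isCoprime_U_U_succ hab m).of_isCoprime_of_dvd_left hD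
  have h' := (dvd_iff_dvd_of_dvd_sub (hD.trans h))
  exact ⟨fun hx => (hc.pow_right).dvd_of_dvd_mul_right (h'.1 (hx.mul_right _)),
    fun hx => hc.dvd_of_dvd_mul_right (h'.2 (hx.mul_right _))⟩

lemma dvd_two_of_dvd_U_of_dvd_V (hab : IsCoprime a b) {D : ℤ} {n : ℕ} (hU : D ∣ U a b n)
    (hV : D ∣ V a b n) : D ∣ 2 := by
  have hc : IsCoprime D (U a b (n + 1)) := (isCoprime_U_U_succ hab n).of_isCoprime_of_dvd_left hU
  refine hc.dvd_of_dvd_mul_right ?_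
  have : 2 * U a b (n + 1) = V a b n + a * U a b n := by rw [V_eq]; ring
  rw [this]
  exact dvd_add hV (hU.mul_left _)

lemma V_dvd_U_two_mul (n : ℕ) : V a b n ∣ U a b (2 * n) := by
  rw [U_two_mul]; exact dvd_mul_left _ _

/-- For odd `j`, the quotient `V_{dj} / V_d` is an integer prime to `U_d`. -/
lemma exists_V_mul_eq (hab : IsCoprime a b) {d j : ℕ} (hd : 0 < d) (hj : ¬ 2 ∣ j) :
    ∃ w : ℤ, V a b (d * j) = V a b d * w ∧ IsCoprime w (U a b d) := by
  obtain ⟨s, rfl⟩ : ∃ s, j = 2 * s + 1 := ⟨j / 2, by omega⟩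
  clear hj
  -- The congruence pins w to a power of -b modulo U_d, and U_d is prime to b.
  suffices h : ∃ w : ℤ, V a b (d * (2 * s + 1)) = V a b d * w ∧
      U a b d ∣ w - ((-b) ^ d) ^ s by
    obtain ⟨w, hw, e, he⟩ := h
    refine ⟨w, hw, ?_⟩
    have hb : IsCoprime (U a b d) b := by
      obtain ⟨k, rfl⟩ := Nat.exists_eq_add_of_le' hd
      exact isCoprime_U_right hab k
    have : w = ((-b) ^ d) ^ s + U a b d * e := by linear_combination he
    rw [this]
    exact (hb.neg_right.pow_right.pow_right.symm).add_mul_left_left _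
  induction s with
  | zero => exact ⟨1, by simp, by simp⟩
  | succ s ih =>
    obtain ⟨w, hw, e, he⟩ := ih
    -- The middle index is (2s+1)d + d = 2d(s+1), so U_d V_d divides its U-term.
    obtain ⟨Y, hY⟩ : U a b (2 * d) ∣ U a b (d * (2 * s + 1) + d) :=
      U_dvd_U_of_dvd ⟨s + 1, by ring⟩
    rw [U_two_mul] at hY
    refine ⟨(-b) ^ d * w + (a ^ 2 + 4 * b) * U a b d ^ 2 * Y, ?_,
      ⟨(-b) ^ d * e + (a ^ 2 + 4 * b) * U a b d * Y, ?_⟩⟩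
    · rw [show d * (2 * (s + 1) + 1) = d * (2 * s + 1) + 2 * d by ring, V_add_two_mul, hY, hw]
      ring
    · rw [pow_succ]
      linear_combination (-b) ^ d * he

lemma V_dvd_V_mul (hab : IsCoprime a b) {d j : ℕ} (hd : 0 < d) (hj : ¬ 2 ∣ j) :
    V a b d ∣ V a b (d * j) := by
  obtain ⟨w, hw, -⟩ := exists_V_mul_eq hab hd hj
  exact ⟨w, hw⟩

/-! ### Positivity, growth and the divisibility criteria -/

lemma three_le_of_neg (ha : 0 < a) (hΔ : 0 < a ^ 2 + 4 * b) (hb : b < 0) : 3 ≤ a := by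
  by_contra h
  have : a ≤ 2 := by omega
  nlinarith

lemma U_pos_and_le (ha : 0 < a) (hΔ : 0 < a ^ 2 + 4 * b) (hb0 : b ≠ 0) (n : ℕ) :
    0 < U a b (n + 1) ∧ U a b (n + 1) ≤ U a b (n + 2) ∧
      (0 < n → U a b (n + 1) < U a b (n + 2)) ∧ a * U a b (n + 1) < 2 * U a b (n + 2) := by
  rcases lt_or_gt_of_ne hb0 with hb | hb
  · have ha3 := three_le_of_neg ha hΔ hb
    -- For b < 0, the bound U_{n+2}/U_{n+1} > a/2 is inductive because a² > -4b; since a ≥ 3 it also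
    -- gives strict growth.
    suffices h : 0 < U a b (n + 1) ∧ a * U a b (n + 1) < 2 * U a b (n + 2) by
      obtain ⟨h₁, h₂⟩ := h
      have : U a b (n + 1) < U a b (n + 2) := by nlinarith
      exact ⟨h₁, this.le, fun _ => this, h₂⟩
    induction n with
    | zero => simp [U]; omega
    | succ n ih =>
      obtain ⟨h₁, h₂⟩ := ih
      refine ⟨by show 0 < U a b (n + 2); nlinarith, ?_⟩
      show a * U a b (n + 2) < 2 * U a b (n + 1 + 2)
      rw [U_add_two a b (n + 1)]
      show a * U a b (n + 2) < 2 * (a * U a b (n + 2) + b * U a b (n + 1))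
      nlinarith
  · suffices h : 0 < U a b (n + 1) ∧ 0 ≤ U a b n ∧ (0 < n → 0 < U a b n) by
      obtain ⟨h₁, h₂, h₃⟩ := h
      have h₄ := U_add_two a b n
      have h₅ : 0 ≤ b * U a b n := by positivity
      refine ⟨h₁, by nlinarith, fun hn => ?_, by nlinarith⟩
      have := mul_pos hb (h₃ hn)
      nlinarith
    induction n with
    | zero => simp [U]
    | succ n ih =>
      obtain ⟨h₁, h₂, -⟩ := ih
      refine ⟨?_, h₁.le, fun _ => h₁⟩
      rw [U_add_two]; positivity

lemma U_pos (ha : 0 < a) (hΔ : 0 < a ^ 2 + 4 * b) (hb : b ≠ 0)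
    {n : ℕ} (hn : 0 < n) : 0 < U a b n := by
  obtain ⟨k, rfl⟩ := Nat.exists_eq_add_of_le' hn
  exact (U_pos_and_le ha hΔ hb k).1

lemma U_le_U (ha : 0 < a) (hΔ : 0 < a ^ 2 + 4 * b) (hb : b ≠ 0)
    {m n : ℕ} (hm : 0 < m) (h : m ≤ n) : U a b m ≤ U a b n := by
  induction n, h using Nat.le_induction with
  | base => rfl
  | succ n h ih =>
    obtain ⟨k, rfl⟩ := Nat.exists_eq_add_of_le' (hm.trans_le h)
    exact ih.trans (U_pos_and_le ha hΔ hb k).2.1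

lemma U_lt_U (ha : 0 < a) (hΔ : 0 < a ^ 2 + 4 * b) (hb : b ≠ 0)
    {m n : ℕ} (hm : 0 < m) (hn : 3 ≤ n) (h : m < n) : U a b m < U a b n := by
  obtain ⟨k, rfl⟩ := Nat.exists_eq_add_of_le' hn
  exact (U_le_U ha hΔ hb hm (Nat.le_of_lt_succ h)).trans_lt
    ((U_pos_and_le ha hΔ hb (k + 1)).2.2.1 (by omega))

lemma V_pos (ha : 0 < a) (hΔ : 0 < a ^ 2 + 4 * b) (hb : b ≠ 0)
    {n : ℕ} (hn : 0 < n) : 0 < V a b n := by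
  obtain ⟨k, rfl⟩ := Nat.exists_eq_add_of_le' hn
  have := (U_pos_and_le ha hΔ hb k).2.2.2
  rw [V_eq]
  linarith

lemma U_lt_V (ha : 0 < a) (hΔ : 0 < a ^ 2 + 4 * b) (hb : b ≠ 0)
    {n : ℕ} (hn : 3 ≤ n) : U a b n < V a b n := by
  rcases lt_or_gt_of_ne hb with hb' | hb'
  · have hV := V_pos ha hΔ hb (show 0 < n by omega)
    refine lt_of_pow_lt_pow_left₀ 2 hV.le ?_
    rw [V_sq]
    have : 0 < (-b) ^ n := pow_pos (by omega) n
    nlinarith [sq_nonneg (U a b n)]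
  · obtain ⟨k, rfl⟩ := Nat.exists_eq_add_of_le' hn
    have h₁ := U_le_U ha hΔ hb (show 0 < k + 3 by omega) (Nat.le_succ _)
    have h₂ := mul_pos hb' (U_pos ha hΔ hb (show 0 < k + 2 by omega))
    have h₃ := U_add_two a b (k + 2)
    have h₄ := V_eq a b (k + 3)
    simp only [Nat.succ_eq_add_one, add_assoc, Nat.reduceAdd] at *
    linarith

/-- U_m divides U_{gcd(m,k)}, and growth forces the gcd to be m. The bound 3 ≤ m excludes U_1 = U_2,
which occurs for a = 1. -/
lemma U_dvd_U_iff (ha : 0 < a) (hΔ : 0 < a ^ 2 + 4 * b) (hb : b ≠ 0)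
    (hab : IsCoprime a b) {m k : ℕ} (hm : 3 ≤ m) :
    U a b m ∣ U a b k ↔ m ∣ k := by
  refine ⟨fun h => ?_, U_dvd_U_of_dvd⟩
  have hg := dvd_U_gcd hab m k dvd_rfl h
  have hpos : 0 < Nat.gcd m k := Nat.gcd_pos_of_pos_left _ (by omega)
  have hle := Int.le_of_dvd (U_pos ha hΔ hb hpos) hg
  rcases (Nat.gcd_le_left k (show 0 < m by omega)).lt_or_eq with hlt | heq
  · exact absurd (U_lt_U ha hΔ hb hpos hm hlt) (not_lt.2 hle)
  · exact Nat.gcd_eq_left_iff_dvd.1 heq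

/-- V_n divides U_{gcd(2n,k)}. A proper divisor of 2n is at most n, while U_n < V_n. -/
lemma V_dvd_U_iff (ha : 0 < a) (hΔ : 0 < a ^ 2 + 4 * b) (hb : b ≠ 0)
    (hab : IsCoprime a b) {n k : ℕ} (hn : 3 ≤ n) :
    V a b n ∣ U a b k ↔ 2 * n ∣ k := by
  refine ⟨fun h => ?_, fun h => (V_dvd_U_two_mul n).trans (U_dvd_U_of_dvd h)⟩
  have hg := dvd_U_gcd hab (2 * n) k (V_dvd_U_two_mul n) h
  have hpos : 0 < Nat.gcd (2 * n) k := Nat.gcd_pos_of_pos_left _ (by omega)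
  have hle := Int.le_of_dvd (U_pos ha hΔ hb hpos) hg
  obtain ⟨c, hc⟩ := Nat.gcd_dvd_left (2 * n) k
  by_cases hc1 : c = 1
  · rw [hc1, mul_one] at hc
    exact Nat.gcd_eq_left_iff_dvd.1 hc.symm
  · have hc0 : c ≠ 0 := by rintro rfl; omega
    have : Nat.gcd (2 * n) k ≤ n := by nlinarith [show 2 ≤ c by omega]
    exact absurd ((U_le_U ha hΔ hb hpos this).trans_lt (U_lt_V ha hΔ hb hn)) (not_lt.2 hle)

/-! ### Reducing divisibility of U_k by a product to the cofactor -/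

lemma tau_eq {N : ℤ} {T : ℕ} (hT : 0 < T) (h : ∀ k, N ∣ U a b k ↔ T ∣ k) :
    tau a b N = T := by
  refine le_antisymm (Nat.sInf_le ⟨hT, (h T).2 dvd_rfl⟩) ?_
  have hne : {k : ℕ | 1 ≤ k ∧ N ∣ U a b k}.Nonempty := ⟨T, hT, (h T).2 dvd_rfl⟩
  exact Nat.le_of_dvd (Nat.sInf_mem hne).1 ((h _).1 (Nat.sInf_mem hne).2)

lemma mul_dvd_mul_iff_dvd_mul {A B W g Q : ℤ} (hAB : A * B ≠ 0) (hg : g ≠ 0)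
    (h : W * g = A * B * Q) (X : ℤ) : A * B ∣ W * X ↔ g ∣ Q * X := by
  rw [← mul_dvd_mul_iff_right hg, show W * X * g = A * B * (Q * X) by linear_combination X * h,
    mul_dvd_mul_iff_left hAB]

lemma exists_mul_eq_mul_mul {A B W g : ℤ} (hA : A ∣ W) (hB : B ∣ W)
    (hg : ∀ D, D ∣ A → D ∣ B → D ∣ g) : ∃ Q, W * g = A * B * Q := by
  have h₁ : A * B ∣ W * (Int.gcd A B : ℤ) := by
    rw [Int.gcd_eq_gcd_ab, mul_add]
    refine dvd_add ?_ ?_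
    · rw [← mul_assoc, mul_comm W A]
      exact (mul_dvd_mul_left A hB).mul_right _
    · rw [← mul_assoc]
      exact (mul_dvd_mul_right hA B).mul_right _
  exact h₁.trans (mul_dvd_mul_left W (hg _ (Int.gcd_dvd_left ..) (Int.gcd_dvd_right ..)))

/-- The common engine: e is the part of g left after cancelling what Q contributes. It is g itself
when g and Q are coprime. -/
lemma mul_dvd_U_iff (hab : IsCoprime a b) {A B g Q e : ℤ} {L : ℕ} (hAB : A * B ≠ 0)
    (hg : g ≠ 0) (h : U a b L * g = A * B * Q) (he : ∀ X, g ∣ Q * X ↔ e ∣ X)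
    (heL : e ∣ U a b L) (hL : ∀ k, A * B ∣ U a b k → L ∣ k) (k : ℕ) :
    A * B ∣ U a b k ↔ L * e.natAbs ∣ k := by
  by_cases hk : L ∣ k
  · obtain ⟨t, rfl⟩ := hk
    rcases Nat.eq_zero_or_pos L with rfl | hL0
    · simp [U_zero]
    obtain ⟨X, hX, hD⟩ := exists_U_mul_eq_and_dvd_iff hab L t
    rw [hX, mul_dvd_mul_iff_dvd_mul hAB hg h, he, hD e heL, Nat.mul_dvd_mul_iff_left hL0,
      ← Int.natCast_dvd_natCast, Int.natAbs_dvd]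
  · exact ⟨fun h => absurd (hL k h) hk, fun h => absurd (dvd_of_mul_right_dvd h) hk⟩

lemma isCoprime_of_forall_prime {x y : ℤ} (hx : x ≠ 0)
    (h : ∀ p : ℤ, Prime p → p ∣ x → ¬ p ∣ y) : IsCoprime x y :=
  isCoprime_of_prime_dvd (fun h => hx h.1) h

lemma not_dvd_of_coprime {m n : ℕ} (h : Nat.Coprime m n) {p : ℤ} (hp : Prime p)
    (hm : p ∣ (m : ℤ)) : ¬ p ∣ (n : ℤ) := fun hn =>
  hp.not_isUnit ((Nat.isCoprime_iff_coprime.2 h).isUnit_of_dvd' hm hn)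

/-! ### Products U_m U_n and U_m V_n -/

/-- Cancelling gives U_{drs}/U_{dr} = (U_{ds}/U_d) Q, and modulo p ∣ U_{dr} the left side vanishes
only if p ∣ s. -/
lemma not_dvd_cofactor_U_U (hab : IsCoprime a b) {d r s : ℕ} {p Q : ℤ}
    (hd0 : U a b d ≠ 0) (hr0 : U a b (d * r) ≠ 0)
    (hQ : U a b (d * r * s) * U a b d = U a b (d * r) * U a b (d * s) * Q)
    (hp : p ∣ U a b d) (hs : ¬ p ∣ (s : ℤ)) : ¬ p ∣ Q := by
  intro hpQ
  obtain ⟨X, hX, hD⟩ := exists_U_mul_eq_and_dvd_iff hab (d * r) s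
  obtain ⟨y, hy⟩ : U a b d ∣ U a b (d * s) := U_dvd_U_of_dvd (dvd_mul_right _ _)
  have hXQ : X = y * Q := by
    refine mul_left_cancel₀ hr0 (mul_right_cancel₀ hd0 ?_)
    rw [hX, hy] at hQ
    linear_combination hQ
  exact hs ((hD p (hp.trans (U_dvd_U_of_dvd (dvd_mul_right _ _)))).1 (hXQ ▸ hpQ.mul_left y))

lemma U_mul_U_dvd_U_iff (hab : IsCoprime a b) (ha : 0 < a) (hΔ : 0 < a ^ 2 + 4 * b)
    (hb : b ≠ 0) {d r s : ℕ} (hrs : Nat.Coprime r s) (hr : 3 ≤ d * r) (hs : 3 ≤ d * s) (k : ℕ) :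
    U a b (d * r) * U a b (d * s) ∣ U a b k ↔ d * r * s * (U a b d).natAbs ∣ k := by
  have hd : 0 < d := Nat.pos_of_ne_zero (by rintro rfl; simp at hr)
  have hUd := (U_pos ha hΔ hb hd).ne'
  have hUr := (U_pos ha hΔ hb (show 0 < d * r by omega)).ne'
  have hUs := (U_pos ha hΔ hb (show 0 < d * s by omega)).ne'
  obtain ⟨Q, hQ⟩ : ∃ Q, U a b (d * r * s) * U a b d = U a b (d * r) * U a b (d * s) * Q := by
    refine exists_mul_eq_mul_mul (U_dvd_U_of_dvd (dvd_mul_right _ _))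
      (U_dvd_U_of_dvd ⟨r, by ring⟩) fun D h₁ h₂ => ?_
    have := dvd_U_gcd hab _ _ h₁ h₂
    rwa [Nat.gcd_mul_left, hrs.gcd_eq_one, mul_one] at this
  have hcop : IsCoprime (U a b d) Q := by
    refine isCoprime_of_forall_prime hUd fun p hp hpd => ?_
    by_cases hps : p ∣ (s : ℤ)
    · refine not_dvd_cofactor_U_U hab (s := r) (r := s) hUd hUs ?_ hpd
        (not_dvd_of_coprime hrs.symm hp hps)
      rw [mul_right_comm, hQ]; ring
    · exact not_dvd_cofactor_U_U hab hUd hUr hQ hpd hps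
  refine mul_dvd_U_iff hab (mul_ne_zero hUr hUs) hUd hQ
    (fun X => ⟨hcop.dvd_of_dvd_mul_left, fun h => h.mul_left _⟩)
    (U_dvd_U_of_dvd ⟨r * s, by ring⟩) (fun k hk => ?_) k
  have h₁ := (U_dvd_U_iff ha hΔ hb hab hr).1 (dvd_of_mul_right_dvd hk)
  have h₂ := (U_dvd_U_iff ha hΔ hb hab hs).1 (dvd_of_mul_left_dvd hk)
  have := Nat.lcm_dvd h₁ h₂
  rwa [Nat.lcm_mul_left, hrs.lcm_eq_mul, ← mul_assoc] at this

/-- A common divisor of `U_{2d}` and `V_{dj}`, with `j` odd, divides `V_d`. -/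
lemma dvd_V_of_dvd_U_two_mul (hab : IsCoprime a b) {d j : ℕ} (hd : 0 < d) (hj : ¬ 2 ∣ j) {D : ℤ}
    (hU : D ∣ U a b (2 * d)) (hV : D ∣ V a b (d * j)) : D ∣ V a b d := by
  obtain ⟨w, hw, x, y, hxy⟩ := exists_V_mul_eq hab hd hj
  have : V a b d = x * V a b (d * j) + y * U a b (2 * d) := by
    rw [hw, U_two_mul]; linear_combination (-V a b d) * hxy
  rw [this]
  exact dvd_add (hV.mul_left _) (hU.mul_left _)

lemma U_mul_V_dvd_U_iff_of_odd (hab : IsCoprime a b) (ha : 0 < a) (hΔ : 0 < a ^ 2 + 4 * b)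
    (hb : b ≠ 0) {d r s : ℕ} (hrs : Nat.Coprime r s) (hr2 : ¬ 2 ∣ r) (hr : 3 ≤ d * r)
    (hs : 3 ≤ d * s) (k : ℕ) :
    U a b (d * r) * V a b (d * s) ∣ U a b k ↔ 2 * (d * r * s) ∣ k := by
  refine ⟨fun hk => ?_, fun hk => Dvd.dvd.trans ?_ (U_dvd_U_of_dvd hk)⟩
  · have h₁ := (U_dvd_U_iff ha hΔ hb hab hr).1 (dvd_of_mul_right_dvd hk)
    have h₂ := (V_dvd_U_iff ha hΔ hb hab hs).1 (dvd_of_mul_left_dvd hk)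
    have hc : Nat.Coprime r (2 * s) :=
      Nat.Coprime.mul_right ((Nat.prime_two.coprime_iff_not_dvd.2 hr2).symm) hrs
    rw [mul_left_comm] at h₂
    have := Nat.lcm_dvd h₁ h₂
    rw [Nat.lcm_mul_left, hc.lcm_eq_mul] at this
    convert this using 1; ring
  · rw [U_two_mul]
    refine mul_dvd_mul (U_dvd_U_of_dvd (dvd_mul_right _ _)) ?_
    rw [mul_right_comm]
    exact V_dvd_V_mul hab (by omega) hr2

lemma U_mul_V_dvd_U_iff_of_even (hab : IsCoprime a b) (ha : 0 < a) (hΔ : 0 < a ^ 2 + 4 * b)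
    (hb : b ≠ 0) {d r s : ℕ} (hrs : Nat.Coprime r s) (hr2 : 2 ∣ r) (hr : 3 ≤ d * r)
    (hs : 3 ≤ d * s) (k : ℕ) :
    U a b (d * r) * V a b (d * s) ∣ U a b k ↔ d * r * s * (V a b d).natAbs ∣ k := by
  have hd : 0 < d := Nat.pos_of_ne_zero (by rintro rfl; simp at hr)
  have hs2 : ¬ 2 ∣ s := fun h => Nat.not_coprime_of_dvd_of_dvd one_lt_two hr2 h hrs
  have hVd := (V_pos ha hΔ hb hd).ne'
  have hUr := (U_pos ha hΔ hb (show 0 < d * r by omega)).ne'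
  have hVs := (V_pos ha hΔ hb (show 0 < d * s by omega)).ne'
  obtain ⟨h, rfl⟩ := hr2
  have hhs : Nat.Coprime h s := Nat.Coprime.coprime_mul_left hrs
  have hVdUr : V a b d ∣ U a b (d * (2 * h)) :=
    (V_dvd_U_two_mul d).trans (U_dvd_U_of_dvd ⟨h, by ring⟩)
  have hVdVs : V a b d ∣ V a b (d * s) := V_dvd_V_mul hab hd hs2
  obtain ⟨Q, hQ⟩ : ∃ Q, U a b (d * (2 * h) * s) * V a b d =
      U a b (d * (2 * h)) * V a b (d * s) * Q := by
    refine exists_mul_eq_mul_mul (U_dvd_U_of_dvd (dvd_mul_right _ _))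
      ((V_dvd_U_two_mul _).trans (U_dvd_U_of_dvd ⟨h, by ring⟩)) fun D h₁ h₂ => ?_
    refine dvd_V_of_dvd_U_two_mul hab hd hs2 ?_ h₂
    have := dvd_U_gcd hab _ _ h₁ (h₂.trans (V_dvd_U_two_mul _))
    rwa [show d * (2 * h) = 2 * d * h by ring, show 2 * (d * s) = 2 * d * s by ring,
      Nat.gcd_mul_left, hhs.gcd_eq_one, mul_one] at this
  have hcop : IsCoprime (V a b d) Q := by
    refine isCoprime_of_forall_prime hVd fun p hp hpd hpQ => ?_
    by_cases hps : p ∣ (s : ℤ)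
    -- As p divides the odd s, it is odd and misses h. Expanding U_{2ds·h} along h leaves U_{ds} as
    -- an extra factor, but p ∣ V_{ds} and p ∤ 2 exclude p ∣ U_{ds}.
    · have hp2 : ¬ p ∣ 2 := fun h2 => not_dvd_of_coprime
        (Nat.prime_two.coprime_iff_not_dvd.2 hs2) hp (by exact_mod_cast h2) hps
      obtain ⟨X, hX, hD⟩ := exists_U_mul_eq_and_dvd_iff hab (2 * (d * s)) h
      obtain ⟨z, hz⟩ := hVdUr
      have hXQ : U a b (d * s) * X = z * Q := by
        refine mul_left_cancel₀ hVs (mul_right_cancel₀ hVd ?_)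
        rw [show d * (2 * h) * s = 2 * (d * s) * h by ring, hX, U_two_mul, hz] at hQ
        linear_combination hQ
      have hpV := hpd.trans hVdVs
      rcases hp.dvd_or_dvd (hXQ ▸ hpQ.mul_left z : p ∣ U a b (d * s) * X) with h₁ | h₁
      · exact hp2 (dvd_two_of_dvd_U_of_dvd_V hab h₁ hpV)
      · exact not_dvd_of_coprime hhs hp
          ((hD p (hpV.trans (V_dvd_U_two_mul _))).1 h₁) hps
    · obtain ⟨X, hX, hD⟩ := exists_U_mul_eq_and_dvd_iff hab (d * (2 * h)) s
      obtain ⟨y, hy⟩ := hVdVs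
      have hXQ : X = y * Q := by
        refine mul_left_cancel₀ hUr (mul_right_cancel₀ hVd ?_)
        rw [hX, hy] at hQ
        linear_combination hQ
      exact hps ((hD p (hpd.trans hVdUr)).1 (hXQ ▸ hpQ.mul_left y))
  refine mul_dvd_U_iff hab (mul_ne_zero hUr hVs) hVd hQ
    (fun X => ⟨hcop.dvd_of_dvd_mul_left, fun h => h.mul_left _⟩)
    (hVdUr.trans (U_dvd_U_of_dvd (dvd_mul_right _ _))) (fun k hk => ?_) k
  have h₁ := (U_dvd_U_iff ha hΔ hb hab hr).1 (dvd_of_mul_right_dvd hk)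
  have h₂ := (V_dvd_U_iff ha hΔ hb hab hs).1 (dvd_of_mul_left_dvd hk)
  have := Nat.lcm_dvd h₁ ((dvd_mul_left _ _).trans h₂)
  rwa [Nat.lcm_mul_left, hrs.lcm_eq_mul, ← mul_assoc] at this

/-! ### Products V_m V_n -/

lemma not_dvd_cofactor_V_V (hab : IsCoprime a b) {d r s : ℕ} {p R : ℤ}
    (hd : 0 < d) (hs2 : ¬ 2 ∣ s) (hd0 : V a b d ≠ 0) (hU0 : U a b (d * r) ≠ 0)
    (hV0 : V a b (d * r) ≠ 0)
    (hR : V a b (d * r * s) * V a b d = V a b (d * r) * V a b (d * s) * R)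
    (hp : p ∣ V a b d) (hpr : V a b d ∣ V a b (d * r)) (hs : ¬ p ∣ (s : ℤ)) : ¬ p ∣ R := by
  intro hpR
  obtain ⟨X, hX, hD⟩ := exists_U_mul_eq_and_dvd_iff hab (2 * (d * r)) s
  obtain ⟨y, hy⟩ := V_dvd_V_mul hab hd hs2
  obtain ⟨z, hz⟩ : U a b (d * r) ∣ U a b (d * r * s) := U_dvd_U_of_dvd (dvd_mul_right _ _)
  have hXR : X = z * y * R := by
    refine mul_left_cancel₀ hU0 (mul_left_cancel₀ hV0 (mul_right_cancel₀ hd0 ?_))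
    rw [mul_assoc 2, U_two_mul, U_two_mul, hz] at hX
    rw [hy] at hR
    linear_combination (-V a b d) * hX + U a b (d * r) * z * hR
  exact hs ((hD p ((hp.trans hpr).trans (V_dvd_U_two_mul _))).1 (hXR ▸ hpR.mul_left _))

lemma gcd_V_V_of_odd (hab : IsCoprime a b) {d r s : ℕ} (hd : 0 < d) (hrs : Nat.Coprime r s)
    (hs2 : ¬ 2 ∣ s) {D : ℤ}
    (h₁ : D ∣ V a b (d * r)) (h₂ : D ∣ V a b (d * s)) : D ∣ V a b d := by
  refine dvd_V_of_dvd_U_two_mul hab hd hs2 ?_ h₂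
  have := dvd_U_gcd hab _ _ (h₁.trans (V_dvd_U_two_mul _)) (h₂.trans (V_dvd_U_two_mul _))
  rwa [← mul_assoc, ← mul_assoc, Nat.gcd_mul_left, hrs.gcd_eq_one, mul_one] at this

lemma two_mul_dvd_of_V_mul_V_dvd (hab : IsCoprime a b) (ha : 0 < a) (hΔ : 0 < a ^ 2 + 4 * b)
    (hb : b ≠ 0) {d r s : ℕ} (hrs : Nat.Coprime r s) (hr : 3 ≤ d * r) (hs : 3 ≤ d * s) {k : ℕ}
    (hk : V a b (d * r) * V a b (d * s) ∣ U a b k) : 2 * (d * r * s) ∣ k := by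
  have h₁ := (V_dvd_U_iff ha hΔ hb hab hr).1 (dvd_of_mul_right_dvd hk)
  have h₂ := (V_dvd_U_iff ha hΔ hb hab hs).1 (dvd_of_mul_left_dvd hk)
  have := Nat.lcm_dvd h₁ h₂
  rwa [Nat.lcm_mul_left, Nat.lcm_mul_left, hrs.lcm_eq_mul, ← mul_assoc d] at this

lemma V_mul_V_dvd_U_iff_of_odd (hab : IsCoprime a b) (ha : 0 < a) (hΔ : 0 < a ^ 2 + 4 * b)
    (hb : b ≠ 0) {d r s : ℕ} (hrs : Nat.Coprime r s) (hr2 : ¬ 2 ∣ r) (hs2 : ¬ 2 ∣ s)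
    (hr : 3 ≤ d * r) (hs : 3 ≤ d * s) {c e f : ℤ} (hc0 : c ≠ 0) (he : V a b d = c * e)
    (hf : U a b (d * r * s) = c * f) (hef : IsCoprime e f) (k : ℕ) :
    V a b (d * r) * V a b (d * s) ∣ U a b k ↔ 2 * (d * r * s) * e.natAbs ∣ k := by
  have hd : 0 < d := Nat.pos_of_ne_zero (by rintro rfl; simp at hr)
  have hVd := (V_pos ha hΔ hb hd).ne'
  have hUr := (U_pos ha hΔ hb (show 0 < d * r by omega)).ne'
  have hUs := (U_pos ha hΔ hb (show 0 < d * s by omega)).ne'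
  have hVr := (V_pos ha hΔ hb (show 0 < d * r by omega)).ne'
  have hVs := (V_pos ha hΔ hb (show 0 < d * s by omega)).ne'
  have hVdr : V a b d ∣ V a b (d * r) := V_dvd_V_mul hab hd hr2
  have hVds : V a b d ∣ V a b (d * s) := V_dvd_V_mul hab hd hs2
  have hVrL : V a b (d * r) ∣ V a b (d * r * s) := V_dvd_V_mul hab (by omega) hs2
  have hVsL : V a b (d * s) ∣ V a b (d * r * s) := by
    rw [mul_right_comm]; exact V_dvd_V_mul hab (by omega) hr2
  obtain ⟨R, hR⟩ : ∃ R, V a b (d * r * s) * V a b d = V a b (d * r) * V a b (d * s) * R :=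
    exists_mul_eq_mul_mul hVrL hVsL fun D h₁ h₂ => gcd_V_V_of_odd hab hd hrs hs2 h₁ h₂
  have hcop : IsCoprime (V a b d) R := by
    refine isCoprime_of_forall_prime hVd fun p hp hpd => ?_
    by_cases hps : p ∣ (s : ℤ)
    · refine not_dvd_cofactor_V_V hab (s := r) (r := s) hd hr2 hVd hUs hVs ?_ hpd hVds
        (not_dvd_of_coprime hrs.symm hp hps)
      rw [mul_right_comm, hR]; ring
    · exact not_dvd_cofactor_V_V hab hd hs2 hVd hUr hVr hR hpd hVdr hps
  -- The engine runs at index 2L with L = drs; U_{2L} = U_L V_L makes the cofactor U_L R. Only U_L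
  -- can meet V_d, and c is the factor removed from both.
  refine mul_dvd_U_iff hab (mul_ne_zero hVr hVs) hVd (Q := U a b (d * r * s) * R) ?_
    (fun X => ?_) ?_ (fun k hk => two_mul_dvd_of_V_mul_V_dvd hab ha hΔ hb hrs hr hs hk) k
  · rw [U_two_mul]; linear_combination U a b (d * r * s) * hR
  · have h₁ : V a b d ∣ U a b (d * r * s) * R * X ↔ V a b d ∣ U a b (d * r * s) * X := by
      rw [mul_right_comm]
      exact ⟨hcop.dvd_of_dvd_mul_right, fun h => h.mul_right _⟩
    rw [h₁, he, hf, mul_assoc, mul_dvd_mul_iff_left hc0]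
    exact ⟨hef.dvd_of_dvd_mul_left, fun h => h.mul_left _⟩
  · exact (Dvd.intro_left c he.symm).trans (hVdr.trans (hVrL.trans (V_dvd_U_two_mul _)))

/-- The factors split over U_{2L} = U_L V_L, L = drs: V_{dr} ∣ U_{2dr} ∣ U_L as s is even, and
V_{ds} ∣ V_L as r is odd. -/
lemma V_mul_V_dvd_U_iff_of_even (hab : IsCoprime a b) (ha : 0 < a) (hΔ : 0 < a ^ 2 + 4 * b)
    (hb : b ≠ 0) {d r s : ℕ} (hrs : Nat.Coprime r s) (hr2 : ¬ 2 ∣ r) (hs2 : 2 ∣ s)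
    (hr : 3 ≤ d * r) (hs : 3 ≤ d * s) (k : ℕ) :
    V a b (d * r) * V a b (d * s) ∣ U a b k ↔ 2 * (d * r * s) ∣ k := by
  refine ⟨two_mul_dvd_of_V_mul_V_dvd hab ha hΔ hb hrs hr hs,
    fun hk => Dvd.dvd.trans ?_ (U_dvd_U_of_dvd hk)⟩
  rw [U_two_mul]
  refine mul_dvd_mul ((V_dvd_U_two_mul _).trans (U_dvd_U_of_dvd ?_)) ?_
  · rw [mul_comm 2]; exact mul_dvd_mul_left _ hs2
  · rw [mul_right_comm]
    exact V_dvd_V_mul hab (by omega) hr2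

lemma dvd_two_of_dvd_V_of_dvd_V (hab : IsCoprime a b) {d r s : ℕ} (hrs : Nat.Coprime r s)
    (hs2 : 2 ∣ s) {D : ℤ} (h₁ : D ∣ V a b (d * r)) (h₂ : D ∣ V a b (d * s)) : D ∣ 2 := by
  have hD := dvd_U_gcd hab _ _ (h₁.trans (V_dvd_U_two_mul _)) (h₂.trans (V_dvd_U_two_mul _))
  rw [← mul_assoc, ← mul_assoc, Nat.gcd_mul_left, hrs.gcd_eq_one, mul_one] at hD
  refine dvd_two_of_dvd_U_of_dvd_V hab (hD.trans (U_dvd_U_of_dvd ?_)) h₂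
  rw [mul_comm 2]
  exact mul_dvd_mul_left _ hs2

lemma gcd_V_V_eq_of_odd (hab : IsCoprime a b) {d r s : ℕ} (hd : 0 < d) (hrs : Nat.Coprime r s)
    (hr2 : ¬ 2 ∣ r) (hs2 : ¬ 2 ∣ s) :
    Int.gcd (V a b (d * r)) (V a b (d * s)) = (V a b d).natAbs := by
  refine Nat.dvd_antisymm ?_ ?_
  · exact Int.natCast_dvd.1
      (gcd_V_V_of_odd hab hd hrs hs2 (Int.gcd_dvd_left ..) (Int.gcd_dvd_right ..))
  · exact Int.natCast_dvd_natCast.1 (Int.dvd_coe_gcd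
      (Int.natAbs_dvd.2 (V_dvd_V_mul hab hd hr2)) (Int.natAbs_dvd.2 (V_dvd_V_mul hab hd hs2)))

/-- If `V_d` or `U_L` is odd, where `V_d ∣ V_L`, then `V_d` and `U_L` are coprime. -/
lemma isCoprime_V_U (hab : IsCoprime a b) {d L : ℕ} (hdL : V a b d ∣ V a b L)
    (h : ¬ (2 ∣ V a b d ∧ 2 ∣ U a b L)) : IsCoprime (V a b d) (U a b L) := by
  rw [Int.isCoprime_iff_gcd_eq_one]
  have h2 : (Int.gcd (V a b d) (U a b L) : ℤ) ∣ 2 := dvd_two_of_dvd_U_of_dvd_V hab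
    (Int.gcd_dvd_right ..) ((Int.gcd_dvd_left ..).trans hdL)
  rcases (Nat.dvd_prime Nat.prime_two).1 (Int.natCast_dvd_natCast.1 (by exact_mod_cast h2)) with
    h' | h'
  · exact h'
  · refine absurd ⟨?_, ?_⟩ h
    · have := Int.gcd_dvd_left (V a b d) (U a b L)
      rwa [h'] at this
    · have := Int.gcd_dvd_right (V a b d) (U a b L)
      rwa [h'] at this

/-- The halves of `V_d` and `U_L` are coprime when `V_d ∣ V_L`. -/
lemma isCoprime_half_V_half_U (hab : IsCoprime a b) {d L : ℕ} (hL : 0 < L)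
    (hdL : V a b d ∣ V a b L) {e f : ℤ} (he : V a b d = 2 * e) (hf : U a b L = 2 * f) :
    IsCoprime e f := by
  obtain ⟨y, hy⟩ := hdL
  -- V_L² - Δ U_L² = 4(-b)^L divided by 4: a common factor of e and f divides a power of b, to which
  -- f is coprime.
  have hsq : e * (e * y ^ 2) + f * (-(a ^ 2 + 4 * b) * f) = (-b) ^ L := by
    have := V_sq a b L
    rw [hy, he, hf] at this
    linarith
  obtain ⟨l, rfl⟩ := Nat.exists_eq_add_of_le' hL
  have hfb : IsCoprime f ((-b) ^ (l + 1)) :=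
    ((isCoprime_U_right hab l).of_isCoprime_of_dvd_left
      (Dvd.intro_left 2 hf.symm)).neg_right.pow_right
  rw [← hsq] at hfb
  have := hfb.symm.of_add_mul_left_left
  exact this.of_mul_left_left

/-! ### Parity of U and V, and 2-adic valuations of the indices -/

lemma two_dvd_U_iff_two_dvd (hab : IsCoprime a b) (ha : 2 ∣ a) (k : ℕ) :
    2 ∣ U a b k ↔ 2 ∣ k := by
  have h2 : 2 ∣ U a b 2 := by rwa [U_two]
  refine ⟨fun h => ?_, fun h => h2.trans (U_dvd_U_of_dvd h)⟩
  have := dvd_U_gcd hab 2 k h2 h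
  by_contra hk
  rw [(Nat.prime_two.coprime_iff_not_dvd.2 hk).gcd_eq_one, U_one] at this
  omega

lemma two_dvd_U_iff_three_dvd (hab : IsCoprime a b) (ha : ¬ 2 ∣ a) (hb : ¬ 2 ∣ b) (k : ℕ) :
    2 ∣ U a b k ↔ 3 ∣ k := by
  have h2 : 2 ∣ U a b 3 := by
    rw [U_three]
    rw [← even_iff_two_dvd] at *
    simp only [Int.even_add, Int.even_pow]
    tauto
  refine ⟨fun h => ?_, fun h => h2.trans (U_dvd_U_of_dvd h)⟩
  have := dvd_U_gcd hab 3 k h2 h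
  by_contra hk
  rw [(Nat.prime_three.coprime_iff_not_dvd.2 hk).gcd_eq_one, U_one] at this
  omega

lemma two_dvd_V_of_two_dvd (ha : 2 ∣ a) (k : ℕ) : 2 ∣ V a b k := by
  rw [V_eq]
  exact dvd_sub (dvd_mul_right _ _) (ha.mul_right _)

lemma two_dvd_V_iff_three_dvd (hab : IsCoprime a b) (ha : ¬ 2 ∣ a) (hb : ¬ 2 ∣ b) (k : ℕ) :
    2 ∣ V a b k ↔ 3 ∣ k := by
  rw [← two_dvd_U_iff_three_dvd hab ha hb, V_eq, dvd_sub_right (dvd_mul_right _ _),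
    Int.prime_two.dvd_mul, or_iff_right ha]

lemma not_two_dvd_V (hab : IsCoprime a b) (hb : 2 ∣ b) {k : ℕ} (hk : 0 < k) :
    ¬ 2 ∣ V a b k := by
  obtain ⟨l, rfl⟩ := Nat.exists_eq_add_of_le' hk
  exact fun h => Int.prime_two.not_isUnit ((isCoprime_V_right hab l).isUnit_of_dvd' h hb)

lemma padicValNat_two_mul_le_iff {d r s : ℕ} (hd : d ≠ 0) (hr : r ≠ 0) (hs : s ≠ 0)
    (hrs : Nat.Coprime r s) :
    padicValNat 2 (d * r) ≤ padicValNat 2 (d * s) ↔ ¬ 2 ∣ r := by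
  rw [padicValNat.mul hd hr, padicValNat.mul hd hs, Nat.add_le_add_iff_left]
  refine ⟨fun h h2 => ?_, fun h => ?_⟩
  · have hs2 : ¬ 2 ∣ s := fun h' => Nat.not_coprime_of_dvd_of_dvd one_lt_two h2 h' hrs
    rw [padicValNat.eq_zero_of_not_dvd hs2] at h
    have := one_le_padicValNat_of_dvd hr h2
    omega
  · rw [padicValNat.eq_zero_of_not_dvd h]
    exact Nat.zero_le _

/-! ### Admissibility and the orders of appearance -/

lemma Admissible.mul {x y : ℤ} (hx : Admissible b x) (hy : Admissible b y) :
    Admissible b (x * y) :=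
  ⟨mul_pos hx.1 hy.1, hx.2.mul_left hy.2⟩

lemma admissible_U (hab : IsCoprime a b) (ha : 0 < a) (hΔ : 0 < a ^ 2 + 4 * b) (hb : b ≠ 0)
    {n : ℕ} (hn : 0 < n) : Admissible b (U a b n) := by
  refine ⟨U_pos ha hΔ hb hn, ?_⟩
  obtain ⟨k, rfl⟩ := Nat.exists_eq_add_of_le' hn
  exact isCoprime_U_right hab k

lemma admissible_V (hab : IsCoprime a b) (ha : 0 < a) (hΔ : 0 < a ^ 2 + 4 * b) (hb : b ≠ 0)
    {n : ℕ} (hn : 0 < n) : Admissible b (V a b n) := by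
  refine ⟨V_pos ha hΔ hb hn, ?_⟩
  obtain ⟨k, rfl⟩ := Nat.exists_eq_add_of_le' hn
  exact isCoprime_V_right hab k

/-- The order of appearance of `V_m V_n` when `m` and `n` have the same `2`-adic valuation. -/
lemma tau_V_mul_V_of_odd (hab : IsCoprime a b) (ha : 0 < a) (hΔ : 0 < a ^ 2 + 4 * b)
    (hb : b ≠ 0) {d r s : ℕ} (hrs : Nat.Coprime r s) (hr2 : ¬ 2 ∣ r) (hs2 : ¬ 2 ∣ s)
    (hr : 3 ≤ d * r) (hs : 3 ≤ d * s) :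
    ((2 ∣ V a b d ∧ 2 ∣ U a b (d * r * s)) → tau a b (V a b (d * r) * V a b (d * s)) =
        d * r * s * Int.gcd (V a b (d * r)) (V a b (d * s))) ∧
    (¬ (2 ∣ V a b d ∧ 2 ∣ U a b (d * r * s)) → tau a b (V a b (d * r) * V a b (d * s)) =
        2 * (d * r * s) * Int.gcd (V a b (d * r)) (V a b (d * s))) := by
  have hd : 0 < d := Nat.pos_of_ne_zero (by rintro rfl; simp at hr)
  have hs0 : 0 < s := Nat.pos_of_ne_zero (by rintro rfl; simp at hs)
  have hL : 0 < d * r * s := Nat.mul_pos (by omega) hs0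
  have hVd := (V_pos ha hΔ hb hd).ne'
  have hdL : V a b d ∣ V a b (d * r * s) :=
    (V_dvd_V_mul hab hd hr2).trans (V_dvd_V_mul hab (by omega) hs2)
  rw [gcd_V_V_eq_of_odd hab hd hrs hr2 hs2]
  refine ⟨fun ⟨⟨e, he⟩, ⟨f, hf⟩⟩ => ?_, fun h => ?_⟩
  · have he0 : e ≠ 0 := by rintro rfl; simp [he] at hVd
    rw [tau_eq (T := 2 * (d * r * s) * e.natAbs) (by positivity)
      (V_mul_V_dvd_U_iff_of_odd hab ha hΔ hb hrs hr2 hs2 hr hs two_ne_zero he hf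
        (isCoprime_half_V_half_U hab hL hdL he hf)), he, Int.natAbs_mul,
      show (2 : ℤ).natAbs = 2 from rfl]
    ring
  · exact tau_eq (by positivity) (V_mul_V_dvd_U_iff_of_odd hab ha hΔ hb hrs hr2 hs2 hr hs
      one_ne_zero (one_mul _).symm (one_mul _).symm (isCoprime_V_U hab hdL h))

/-- The order of appearance of `V_m V_n` when `m` and `n` have different `2`-adic valuations. -/
lemma tau_V_mul_V_of_even (hab : IsCoprime a b) (ha : 0 < a) (hΔ : 0 < a ^ 2 + 4 * b)
    (hb : b ≠ 0) {d r s : ℕ} (hrs : Nat.Coprime r s) (hr2 : ¬ 2 ∣ r) (hs2 : 2 ∣ s)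
    (hr : 3 ≤ d * r) (hs : 3 ≤ d * s) :
    ((2 ∣ V a b (d * r) ∧ 2 ∣ V a b (d * s)) → tau a b (V a b (d * r) * V a b (d * s)) =
        d * r * s * Int.gcd (V a b (d * r)) (V a b (d * s))) ∧
    (¬ (2 ∣ V a b (d * r) ∧ 2 ∣ V a b (d * s)) → tau a b (V a b (d * r) * V a b (d * s)) =
        2 * (d * r * s) * Int.gcd (V a b (d * r)) (V a b (d * s))) := by
  have hs0 : 0 < s := Nat.pos_of_ne_zero (by rintro rfl; simp at hs)
  have hL : 0 < d * r * s := Nat.mul_pos (by omega) hs0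
  -- The order is 2L in both clauses; gcd 2 or gcd 1 only changes how it is written.
  have hg : Int.gcd (V a b (d * r)) (V a b (d * s)) ∣ 2 := by
    have : (Int.gcd (V a b (d * r)) (V a b (d * s)) : ℤ) ∣ 2 :=
      dvd_two_of_dvd_V_of_dvd_V hab hrs hs2 (Int.gcd_dvd_left ..) (Int.gcd_dvd_right ..)
    exact_mod_cast this
  rw [tau_eq (by positivity) (V_mul_V_dvd_U_iff_of_even hab ha hΔ hb hrs hr2 hs2 hr hs)]
  refine ⟨fun h => ?_, fun h => ?_⟩
  · have h2 : 2 ∣ Int.gcd (V a b (d * r)) (V a b (d * s)) :=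
      Int.natCast_dvd_natCast.1 (Int.dvd_coe_gcd h.1 h.2)
    rw [Nat.dvd_antisymm hg h2, mul_comm]
  · rcases (Nat.dvd_prime Nat.prime_two).1 hg with h' | h'
    · rw [h', mul_one]
    · refine absurd ⟨?_, ?_⟩ h
      · have := Int.gcd_dvd_left (V a b (d * r)) (V a b (d * s))
        rwa [h'] at this
      · have := Int.gcd_dvd_right (V a b (d * r)) (V a b (d * s))
        rwa [h'] at this

end LucasPair

open LucasPair

theorem theorem1p1 (a b : ℤ) (hab : IsCoprime a b) (hnd : LucasPair.Nondegenerate a b)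
    (ha : 0 < a) (hΔ : 0 < a ^ 2 + 4 * b) (m n : ℕ) (hm : 3 ≤ m) (hn : 3 ≤ n)
    (d : ℕ) (hd : d = Nat.gcd m n) :
    -- (i)
    (LucasPair.Admissible b (LucasPair.U a b m * LucasPair.V a b n) ∧
      (padicValNat 2 m ≤ padicValNat 2 n →
        (LucasPair.tau a b (LucasPair.U a b m * LucasPair.V a b n) : ℤ) =
          2 * (Nat.lcm m n : ℤ)) ∧
      (padicValNat 2 n < padicValNat 2 m →
        (LucasPair.tau a b (LucasPair.U a b m * LucasPair.V a b n) : ℤ) =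
          (Nat.lcm m n : ℤ) * LucasPair.V a b d)) ∧
    -- (ii)
    (LucasPair.Admissible b (LucasPair.U a b m * LucasPair.U a b n) ∧
      (LucasPair.tau a b (LucasPair.U a b m * LucasPair.U a b n) : ℤ) =
        (Nat.lcm m n : ℤ) * LucasPair.U a b d) ∧
    -- (iii)
    (LucasPair.Admissible b (LucasPair.V a b m * LucasPair.V a b n) ∧
      ((¬ 2 ∣ b ∧ 2 ∣ a ∧ 2 ∣ d) ∨ (¬ 2 ∣ b ∧ ¬ 2 ∣ a ∧ 3 ∣ d) ∨
          (¬ 2 ∣ b ∧ 2 ∣ a ∧ ¬ 2 ∣ d ∧ padicValNat 2 m ≠ padicValNat 2 n) →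
        LucasPair.tau a b (LucasPair.V a b m * LucasPair.V a b n) =
          Nat.lcm m n * Int.gcd (LucasPair.V a b m) (LucasPair.V a b n)) ∧
      (2 ∣ b ∨ (¬ 2 ∣ b ∧ ¬ 2 ∣ a ∧ ¬ 3 ∣ d) ∨
          (¬ 2 ∣ b ∧ 2 ∣ a ∧ ¬ 2 ∣ d ∧ padicValNat 2 m = padicValNat 2 n) →
        LucasPair.tau a b (LucasPair.V a b m * LucasPair.V a b n) =
          2 * Nat.lcm m n * Int.gcd (LucasPair.V a b m) (LucasPair.V a b n))) := by
  have hb := hnd.1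
  obtain ⟨r, s, hrs, hmr, hns⟩ := Nat.exists_coprime m n
  rw [← hd, mul_comm] at hmr hns
  clear hd
  subst hmr hns
  have hd : 0 < d := Nat.pos_of_ne_zero (by rintro rfl; simp at hm)
  have hr0 : r ≠ 0 := by rintro rfl; simp at hm
  have hs0 : s ≠ 0 := by rintro rfl; simp at hn
  have hL : 0 < d * r * s := by positivity
  have hUd := U_pos ha hΔ hb hd
  have hVd := V_pos ha hΔ hb hd
  have hUm : Admissible b (U a b (d * r)) := admissible_U hab ha hΔ hb (by omega)
  have hUn : Admissible b (U a b (d * s)) := admissible_U hab ha hΔ hb (by omega)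
  have hVm : Admissible b (V a b (d * r)) := admissible_V hab ha hΔ hb (by omega)
  have hVn : Admissible b (V a b (d * s)) := admissible_V hab ha hΔ hb (by omega)
  have hle := padicValNat_two_mul_le_iff hd.ne' hr0 hs0 hrs
  have hge := padicValNat_two_mul_le_iff hd.ne' hs0 hr0 hrs.symm
  rw [Nat.lcm_mul_left, hrs.lcm_eq_mul, ← mul_assoc]
  refine ⟨⟨hUm.mul hVn, fun h => ?_, fun h => ?_⟩, ⟨hUm.mul hUn, ?_⟩, hVm.mul hVn, ?_⟩
  · rw [tau_eq (by positivity)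
      (U_mul_V_dvd_U_iff_of_odd hab ha hΔ hb hrs (hle.1 h) hm hn)]
    push_cast; ring
  · rw [tau_eq (by positivity) (U_mul_V_dvd_U_iff_of_even hab ha hΔ hb hrs
      (not_not.1 fun h' => absurd (hle.2 h') (not_le.2 h)) hm hn), Nat.cast_mul,
      Int.natCast_natAbs, abs_of_pos hVd]
  · rw [tau_eq (by positivity) (U_mul_U_dvd_U_iff hab ha hΔ hb hrs hm hn), Nat.cast_mul,
      Int.natCast_natAbs, abs_of_pos hUd]
  have hL3 : 3 ∣ d → 3 ∣ d * r * s := fun h => (h.mul_right r).mul_right s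
  have hL2 : 2 ∣ d → 2 ∣ d * r * s := fun h => (h.mul_right r).mul_right s
  have heven : (¬ 2 ∣ b ∧ 2 ∣ a ∧ 2 ∣ d) ∨ (¬ 2 ∣ b ∧ ¬ 2 ∣ a ∧ 3 ∣ d) ∨
      (¬ 2 ∣ b ∧ 2 ∣ a ∧ ¬ 2 ∣ d ∧ padicValNat 2 (d * r) ≠ padicValNat 2 (d * s)) →
      2 ∣ V a b (d * r) ∧ 2 ∣ V a b (d * s) := by
    rintro (⟨-, h, -⟩ | ⟨h₁, h₂, h₃⟩ | ⟨-, h, -, -⟩)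
    · exact ⟨two_dvd_V_of_two_dvd h _, two_dvd_V_of_two_dvd h _⟩
    · exact ⟨(two_dvd_V_iff_three_dvd hab h₂ h₁ _).2 (h₃.mul_right r),
        (two_dvd_V_iff_three_dvd hab h₂ h₁ _).2 (h₃.mul_right s)⟩
    · exact ⟨two_dvd_V_of_two_dvd h _, two_dvd_V_of_two_dvd h _⟩
  have hodd : padicValNat 2 (d * r) ≠ padicValNat 2 (d * s) →
      (2 ∣ b ∨ (¬ 2 ∣ b ∧ ¬ 2 ∣ a ∧ ¬ 3 ∣ d) ∨
        (¬ 2 ∣ b ∧ 2 ∣ a ∧ ¬ 2 ∣ d ∧ padicValNat 2 (d * r) = padicValNat 2 (d * s))) →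
      ¬ (2 ∣ V a b (d * r) ∧ 2 ∣ V a b (d * s)) := by
    rintro hne (h | ⟨h₁, h₂, h₃⟩ | ⟨-, -, -, h⟩) ⟨h₄, h₅⟩
    · exact not_two_dvd_V hab h (by omega) h₄
    · rw [two_dvd_V_iff_three_dvd hab h₂ h₁] at h₄ h₅
      have := Nat.dvd_gcd h₄ h₅
      rw [Nat.gcd_mul_left, hrs.gcd_eq_one, mul_one] at this
      exact h₃ this
    · exact hne h
  -- Coprime r, s are not both even, and the valuations of m and n agree exactly when both are odd.
  -- If r is even, the roles of m and n are exchanged.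
  by_cases hr2 : 2 ∣ r
  · have hs2 : ¬ 2 ∣ s := fun h' => Nat.not_coprime_of_dvd_of_dvd one_lt_two hr2 h' hrs
    have key := tau_V_mul_V_of_even hab ha hΔ hb hrs.symm hs2 hr2 hn hm
    have hne : padicValNat 2 (d * r) ≠ padicValNat 2 (d * s) := fun h => hle.1 h.le hr2
    rw [mul_comm (V a b (d * r)), Int.gcd_comm, mul_right_comm d]
    exact ⟨fun h => key.1 (heven h).symm, fun h => key.2 fun h' => hodd hne h h'.symm⟩
  by_cases hs2 : 2 ∣ s
  · have key := tau_V_mul_V_of_even hab ha hΔ hb hrs hr2 hs2 hm hn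
    have hne : padicValNat 2 (d * r) ≠ padicValNat 2 (d * s) := fun h => hge.1 h.ge hs2
    exact ⟨fun h => key.1 (heven h), fun h => key.2 (hodd hne h)⟩
  have key := tau_V_mul_V_of_odd hab ha hΔ hb hrs hr2 hs2 hm hn
  have heq : padicValNat 2 (d * r) = padicValNat 2 (d * s) := le_antisymm (hle.2 hr2) (hge.2 hs2)
  refine ⟨fun h => key.1 ?_, fun h => key.2 ?_⟩
  · rcases h with ⟨h₁, h₂, h₃⟩ | ⟨h₁, h₂, h₃⟩ | ⟨-, -, -, h⟩
    · exact ⟨two_dvd_V_of_two_dvd h₂ _, (two_dvd_U_iff_two_dvd hab h₂ _).2 (hL2 h₃)⟩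
    · exact ⟨(two_dvd_V_iff_three_dvd hab h₂ h₁ _).2 h₃,
        (two_dvd_U_iff_three_dvd hab h₂ h₁ _).2 (hL3 h₃)⟩
    · exact absurd heq h
  · rintro ⟨h₄, h₅⟩
    rcases h with h | ⟨h₁, h₂, h₃⟩ | ⟨h₁, h₂, h₃, -⟩
    · exact not_two_dvd_V hab h hd h₄
    · exact h₃ ((two_dvd_V_iff_three_dvd hab h₂ h₁ _).1 h₄)
    · have := (two_dvd_U_iff_two_dvd hab h₂ _).1 h₅
      simp only [Nat.prime_two.dvd_mul, h₃, hr2, hs2, or_self] at this
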